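/- For $k\ge 1$ and a field $K$ of characteristic zero let $\mathfrak h_{2k+1}(K)$ be the Heisenberg Lie algebra over $K$, with basis $X_1,\dots,X_{2k},Z$ and nonzero brackets $[X_{2i-1},X_{2i}]=Z$ ($1\le i\le k$); write $\mathfrak h_{2k+1}=\mathfrak h_{2k+1}(\mathbb R)$. A rational form of an $n$-dimensional real Lie algebra $\mathfrak n$ is an $n$-dimensional $\mathbb Q$-subspace of $\mathfrak n$ that spans $\mathfrak n$ over $\mathbb R$ and is closed under the bracket; two rational forms are isomorphic if an automorphism of $\mathfrak n$ carries one onto the other. The real Lie algebra $\mathfrak n=\mathfrak h_3\oplus\mathfrak h_5$ is of type $(6,2)$, i.e. it is two-step nilpotent with $\dim \mathfrak n/[\mathfrak n,\mathfrak n]=6$ and $\dim[\mathfrak n,\mathfrak n]=2$. It has exactly one rational form up to isomorphism: there is a rational form $(\mathfrak h_3\oplus\mathfrak h_5)^{\mathbb Q}$, isomorphic as a Lie algebra over $\mathbb Q$ to $\mathfrak h_3(\mathbb Q)\oplus\mathfrak h_5(\mathbb Q)$, and every rational form of $\mathfrak h_3\oplus\mathfrak h_5$ is isomorphic to it, both by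 an automorphism of $\mathfrak h_3\oplus\mathfrak h_5$ and as a Lie algebra over $\mathbb Q$. Moreover, let $\mathrm{GL}_2(K)$ act on binary forms over $K$ by $(A.f)(x,y)=f(A^{-1}(x,y))$, and let $f(x,y)=xy^2$. Then the elements of the orbit $\mathrm{GL}_2(\mathbb R).f$ all of whose coefficients are rational are exactly the elements of $\mathrm{GL}_2(\mathbb Q).f$; that is, they form a single $\mathrm{GL}_2(\mathbb Q)$-orbit. -/

import Mathlib

/-- The Heisenberg Lie algebra `𝔥_{2k+1}` over `R`, in coordinates: the triple `(x, y, z)` stands for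
`∑ i, x i • X_{2i-1} + ∑ i, y i • X_{2i} + z • Z` (with `i = 1, …, k`), where
`[X_{2i-1}, X_{2i}] = Z` and all other brackets of basis vectors vanish. -/
def HeisenbergLie (k : ℕ) (R : Type*) : Type _ :=
  (Fin k → R) × (Fin k → R) × R

namespace HeisenbergLie

instance instAddCommGroup (k : ℕ) (R : Type*) [CommRing R] : AddCommGroup (HeisenbergLie k R) :=
  inferInstanceAs (AddCommGroup ((Fin k → R) × (Fin k → R) × R))

instance instModule (k : ℕ) (S R : Type*) [CommRing S] [CommRing R] [Algebra S R] :
    Module S (HeisenbergLie k R) :=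
  inferInstanceAs (Module S ((Fin k → R) × (Fin k → R) × R))

/-- The central coordinate of the bracket of two vectors. -/
def form {k : ℕ} {R : Type*} [CommRing R] (u v : HeisenbergLie k R) : R :=
  ∑ i, (u.1 i * v.2.1 i - v.1 i * u.2.1 i)

instance instBracket (k : ℕ) (R : Type*) [CommRing R] :
    Bracket (HeisenbergLie k R) (HeisenbergLie k R) where
  bracket u v := ((0, 0, form u v) : (Fin k → R) × (Fin k → R) × R)

theorem lie_def {k : ℕ} {R : Type*} [CommRing R] (u v : HeisenbergLie k R) :
    ⁅u, v⁆ = ((0, 0, form u v) : (Fin k → R) × (Fin k → R) × R) := rfl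

theorem ext_iff' {k : ℕ} {R : Type*} {u v : HeisenbergLie k R} :
    u = v ↔ u.1 = v.1 ∧ u.2.1 = v.2.1 ∧ u.2.2 = v.2.2 := by
  constructor
  · rintro rfl
    exact ⟨rfl, rfl, rfl⟩
  · rintro ⟨h1, h2, h3⟩
    exact Prod.ext h1 (Prod.ext h2 h3)

theorem form_add_left {k : ℕ} {R : Type*} [CommRing R] (u v w : HeisenbergLie k R) :
    form (u + v) w = form u w + form v w := by
  unfold form
  rw [← Finset.sum_add_distrib]
  refine Finset.sum_congr rfl fun i _ => ?_
  change (u.1 i + v.1 i) * w.2.1 i - w.1 i * (u.2.1 i + v.2.1 i) = _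
  ring

theorem form_swap {k : ℕ} {R : Type*} [CommRing R] (u v : HeisenbergLie k R) :
    form u v = - form v u := by
  unfold form
  rw [← Finset.sum_neg_distrib]
  exact Finset.sum_congr rfl fun i _ => by ring

theorem form_add_right {k : ℕ} {R : Type*} [CommRing R] (u v w : HeisenbergLie k R) :
    form u (v + w) = form u v + form u w := by
  rw [form_swap, form_add_left, form_swap v, form_swap w]
  ring

theorem form_smul_right {k : ℕ} {S R : Type*} [CommRing S] [CommRing R] [Algebra S R] (t : S)
    (u v : HeisenbergLie k R) : form u (t • v) = t • form u v := by
  unfold form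
  rw [Finset.smul_sum]
  refine Finset.sum_congr rfl fun i _ => ?_
  change u.1 i * (t • v.2.1 i) - (t • v.1 i) * u.2.1 i = _
  rw [mul_smul_comm, smul_mul_assoc, smul_sub]

theorem form_self {k : ℕ} {R : Type*} [CommRing R] (u : HeisenbergLie k R) : form u u = 0 :=
  Finset.sum_eq_zero fun i _ => by ring

theorem form_lie_left {k : ℕ} {R : Type*} [CommRing R] (u v w : HeisenbergLie k R) :
    form ⁅u, v⁆ w = 0 :=
  Finset.sum_eq_zero fun i _ => by simp [lie_def]

theorem form_lie_right {k : ℕ} {R : Type*} [CommRing R] (u v w : HeisenbergLie k R) :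
    form u ⁅v, w⁆ = 0 := by
  rw [form_swap, form_lie_left, neg_zero]

instance instLieRing (k : ℕ) (R : Type*) [CommRing R] : LieRing (HeisenbergLie k R) where
  add_lie u v w := ext_iff'.2
    ⟨(add_zero 0).symm, (add_zero 0).symm, form_add_left u v w⟩
  lie_add u v w := ext_iff'.2
    ⟨(add_zero 0).symm, (add_zero 0).symm, form_add_right u v w⟩
  lie_self u := ext_iff'.2 ⟨rfl, rfl, form_self u⟩
  leibniz_lie u v w := ext_iff'.2
    ⟨(add_zero 0).symm, (add_zero 0).symm, by
      change form u ⁅v, w⁆ = form ⁅u, v⁆ w + form v ⁅u, w⁆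
      rw [form_lie_left, form_lie_right, form_lie_right, add_zero]⟩

instance instLieAlgebra (k : ℕ) (S R : Type*) [CommRing S] [CommRing R] [Algebra S R] :
    LieAlgebra S (HeisenbergLie k R) where
  lie_smul t u v := ext_iff'.2
    ⟨(smul_zero t).symm, (smul_zero t).symm, form_smul_right t u v⟩

end HeisenbergLie

/-- A Lie algebra `L` over a field `K` is of type `(n₁, …, n_r)` if `C^r(L) = 0`, `C^s(L) ≠ 0` for
`s < r`, and `n_i = dim C^{i-1}(L) / C^i(L)`, where `C^0(L) = L` and `C^i(L) = [L, C^{i-1}(L)]`. -/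
def HasNilpotentType (K L : Type*) [Field K] [LieRing L] [LieAlgebra K L] (n : List ℕ) : Prop :=
  LieModule.lowerCentralSeries K L L n.length = ⊥ ∧
  (∀ s < n.length, LieModule.lowerCentralSeries K L L s ≠ ⊥) ∧
  ∀ i : Fin n.length,
    Module.finrank K
      ((LieModule.lowerCentralSeries K L L i).toSubmodule ⧸
        (LieModule.lowerCentralSeries K L L (i + 1)).toSubmodule.submoduleOf
          (LieModule.lowerCentralSeries K L L i).toSubmodule) = n.get i

/-- A rational form of a finite-dimensional real Lie algebra `L`: a rational subspace closed under
the bracket, whose dimension over `ℚ` is `dim_ℝ L`, and which spans `L` over `ℝ` (so that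
extending its scalars to `ℝ` gives back `L`). -/
structure IsRationalForm {L : Type*} [LieRing L] [LieAlgebra ℝ L] [LieAlgebra ℚ L]
    [FiniteDimensional ℝ L] (N : LieSubalgebra ℚ L) : Prop where
  finrank_eq : Module.finrank ℚ N = Module.finrank ℝ L
  span_eq_top : Submodule.span ℝ (N : Set L) = ⊤

/-- Two rational forms of a real Lie algebra `L` are isomorphic if an automorphism of `L` carries
one onto the other. -/
def RationalFormsIsomorphic {L : Type*} [LieRing L] [LieAlgebra ℝ L] [LieAlgebra ℚ L]
    (N₁ N₂ : LieSubalgebra ℚ L) : Prop :=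
  ∃ A : L ≃ₗ⁅ℝ⁆ L, A '' (N₁ : Set L) = (N₂ : Set L)

instance HeisenbergLie.instFiniteDimensional (k : ℕ) (K : Type*) [Field K] :
    FiniteDimensional K (HeisenbergLie k K) :=
  inferInstanceAs (FiniteDimensional K ((Fin k → K) × (Fin k → K) × K))

/-- The action of `GL_k(K)` on polynomials in `k` variables by linear substitution,
`(A.f)(x) = f(A⁻¹ x)`. -/
noncomputable def formAct {k : ℕ} {K : Type*} [Field K] (A : GL (Fin k) K)
    (f : MvPolynomial (Fin k) K) : MvPolynomial (Fin k) K :=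
  MvPolynomial.aeval
    (fun i => ∑ j, MvPolynomial.C ((A⁻¹ : GL (Fin k) K) i j) * MvPolynomial.X j) f

/-- The `GL_k(K)`-orbit of a polynomial in `k` variables. -/
def formOrbit {k : ℕ} {K : Type*} [Field K] (f : MvPolynomial (Fin k) K) :
    Set (MvPolynomial (Fin k) K) :=
  Set.range fun A : GL (Fin k) K => formAct A f

/-- The binary cubic form `x y²`. -/
noncomputable def cubicXYY (K : Type*) [Field K] : MvPolynomial (Fin 2) K :=
  MvPolynomial.X 0 * MvPolynomial.X 1 ^ 2

/-! The bracket is `central (ω₁ u v, ω₂ u v)`, where modulo the center `ω₁` has rank two, `ω₂` has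
rank four, and their radicals are complementary. The brackets of a rational form `N` give a rational
structure on the center, so two independent real combinations of `ω₁` and `ω₂` are rational on `N`.
After a rational shift one of them is nondegenerate modulo the center. Relative to it the other is a
rational 6 × 6 matrix with eigenvalues `r` (twice) and `s` (four times). Galois-conjugate
eigenvalues would have equal multiplicities, so `r` and `s` are rational (`rational_ratios`). Hence
`ω₁` and `ω₂` are separately rational on `N` up to real factors (`exists_smul_isRationalOn`).
Symplectic Gram–Schmidt over `ℚ` then produces in `N` a copy of the standard generators, up to those
factors (`exists_adapted_family`), and the factors are absorbed by rescaling the center.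

The cubic `x y²` is, up to sign, the Pfaffian of `x • ω₁ + y • ω₂` modulo the center. For its orbit
the argument is analogous: the double factor is distinguished from the simple one, so both are
rational up to scaling (`exists_rat_factors`). -/

namespace HeisenbergLie

/-- The element of the Heisenberg Lie algebra with the given coordinates. -/
def mk {k : ℕ} {R : Type*} (x y : Fin k → R) (z : R) : HeisenbergLie k R := (x, y, z)

@[simp] theorem mk_fst {k : ℕ} {R : Type*} (x y : Fin k → R) (z : R) : (mk x y z).1 = x := rfl
@[simp] theorem mk_snd_fst {k : ℕ} {R : Type*} (x y : Fin k → R) (z : R) :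
    (mk x y z).2.1 = y := rfl
@[simp] theorem mk_snd_snd {k : ℕ} {R : Type*} (x y : Fin k → R) (z : R) :
    (mk x y z).2.2 = z := rfl

/-! ### Coordinates and rational points of Heisenberg algebras -/

variable {k : ℕ} {R S : Type*} [CommRing R] [CommRing S] [Algebra S R]

@[simp] theorem zero_fst : (0 : HeisenbergLie k R).1 = 0 := rfl
@[simp] theorem zero_snd_fst : (0 : HeisenbergLie k R).2.1 = 0 := rfl
@[simp] theorem zero_snd_snd : (0 : HeisenbergLie k R).2.2 = 0 := rfl
@[simp] theorem add_fst (u v : HeisenbergLie k R) : (u + v).1 = u.1 + v.1 := rfl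
@[simp] theorem add_snd_fst (u v : HeisenbergLie k R) : (u + v).2.1 = u.2.1 + v.2.1 := rfl
@[simp] theorem add_snd_snd (u v : HeisenbergLie k R) : (u + v).2.2 = u.2.2 + v.2.2 := rfl
@[simp] theorem smul_fst (t : S) (u : HeisenbergLie k R) : (t • u).1 = t • u.1 := rfl
@[simp] theorem smul_snd_fst (t : S) (u : HeisenbergLie k R) : (t • u).2.1 = t • u.2.1 := rfl
@[simp] theorem smul_snd_snd (t : S) (u : HeisenbergLie k R) : (t • u).2.2 = t • u.2.2 := rfl

theorem lie_eq_mk (u v : HeisenbergLie k R) : ⁅u, v⁆ = mk 0 0 (form u v) := rfl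

theorem form_smul_left (t : S) (u v : HeisenbergLie k R) : form (t • u) v = t • form u v := by
  rw [form_swap, form_smul_right, form_swap v, smul_neg, neg_neg]

theorem finrank_eq (k : ℕ) (K : Type*) [Field K] :
    Module.finrank K (HeisenbergLie k K) = 2 * k + 1 := by
  have : Module.finrank K (HeisenbergLie k K) =
      Module.finrank K ((Fin k → K) × (Fin k → K) × K) := rfl
  rw [this]
  simp
  ring

/-- The map of Heisenberg Lie algebras induced by extension of scalars from `ℚ` to `ℝ`. -/
def ofRat (k : ℕ) : HeisenbergLie k ℚ →ₗ⁅ℚ⁆ HeisenbergLie k ℝ where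
  toFun u := mk (fun i => (u.1 i : ℝ)) (fun i => (u.2.1 i : ℝ)) (u.2.2 : ℝ)
  map_add' u v := by
    refine ext_iff'.2 ⟨?_, ?_, ?_⟩
    · ext i; simp
    · ext i; simp
    · simp
  map_smul' t u := by
    refine ext_iff'.2 ⟨?_, ?_, ?_⟩
    · ext i; simp [Rat.smul_def]
    · ext i; simp [Rat.smul_def]
    · simp [Rat.smul_def]
  map_lie' {u v} := by
    refine ext_iff'.2 ⟨?_, ?_, ?_⟩
    · ext i; simp [lie_eq_mk]
    · ext i; simp [lie_eq_mk]
    · simp [lie_eq_mk, form]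

theorem ofRat_apply (u : HeisenbergLie k ℚ) :
    ofRat k u = mk (fun i => (u.1 i : ℝ)) (fun i => (u.2.1 i : ℝ)) (u.2.2 : ℝ) := rfl

theorem ofRat_injective : Function.Injective (ofRat k) := by
  intro u v h
  rw [ofRat_apply, ofRat_apply] at h
  obtain ⟨h1, h2, h3⟩ := ext_iff'.1 h
  refine ext_iff'.2 ⟨?_, ?_, ?_⟩
  · ext i; exact Rat.cast_injective (congrFun h1 i)
  · ext i; exact Rat.cast_injective (congrFun h2 i)
  · exact Rat.cast_injective h3

end HeisenbergLie

/-- The real Lie algebra `𝔥₃ ⊕ 𝔥₅`. -/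
abbrev HeisenbergSum : Type := HeisenbergLie 1 ℝ × HeisenbergLie 2 ℝ

/-! ### The two bracket forms and their ranks -/

namespace HeisenbergSum

open HeisenbergLie Matrix

/-- The bracket form of the summand `𝔥₃`. -/
noncomputable def ω₁ : HeisenbergSum →ₗ[ℝ] HeisenbergSum →ₗ[ℝ] ℝ :=
  LinearMap.mk₂ ℝ (fun u v => form u.1 v.1)
    (fun u v w => form_add_left u.1 v.1 w.1) (fun t u v => form_smul_left t u.1 v.1)
    (fun u v w => form_add_right u.1 v.1 w.1) (fun t u v => form_smul_right t u.1 v.1)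

/-- The bracket form of the summand `𝔥₅`. -/
noncomputable def ω₂ : HeisenbergSum →ₗ[ℝ] HeisenbergSum →ₗ[ℝ] ℝ :=
  LinearMap.mk₂ ℝ (fun u v => form u.2 v.2)
    (fun u v w => form_add_left u.2 v.2 w.2) (fun t u v => form_smul_left t u.2 v.2)
    (fun u v w => form_add_right u.2 v.2 w.2) (fun t u v => form_smul_right t u.2 v.2)

theorem ω₁_apply (u v : HeisenbergSum) :
    ω₁ u v = u.1.1 0 * v.1.2.1 0 - v.1.1 0 * u.1.2.1 0 := by
  simp [ω₁, form]

theorem ω₂_apply (u v : HeisenbergSum) :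
    ω₂ u v = u.2.1 0 * v.2.2.1 0 - v.2.1 0 * u.2.2.1 0 +
      (u.2.1 1 * v.2.2.1 1 - v.2.1 1 * u.2.2.1 1) := by
  simp only [ω₂, form, LinearMap.mk₂_apply, Fin.sum_univ_two]

/-- The central elements of `𝔥₃ ⊕ 𝔥₅`. -/
def central : ℝ × ℝ →ₗ[ℝ] HeisenbergSum where
  toFun s := (mk 0 0 s.1, mk 0 0 s.2)
  map_add' _ _ := by
    refine Prod.ext (ext_iff'.2 ⟨?_, ?_, ?_⟩) (ext_iff'.2 ⟨?_, ?_, ?_⟩) <;> simp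
  map_smul' _ _ := by
    refine Prod.ext (ext_iff'.2 ⟨?_, ?_, ?_⟩) (ext_iff'.2 ⟨?_, ?_, ?_⟩) <;> simp

theorem central_apply (s : ℝ × ℝ) : central s = (mk 0 0 s.1, mk 0 0 s.2) := rfl

theorem central_injective : Function.Injective central := fun _ _ h =>
  Prod.ext (congrArg (fun w : HeisenbergSum => w.1.2.2) h)
    (congrArg (fun w : HeisenbergSum => w.2.2.2) h)

theorem lie_eq_central (u v : HeisenbergSum) : ⁅u, v⁆ = central (ω₁ u v, ω₂ u v) := rfl

/-- The standard generator `X_1` of the summand `𝔥₃`. -/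
def X : HeisenbergSum := (mk 1 0 0, 0)
/-- The standard generator `X_2` of the summand `𝔥₃`. -/
def Y : HeisenbergSum := (mk 0 1 0, 0)
/-- The standard generators `X_{2i-1}` of the summand `𝔥₅`. -/
def X' (i : Fin 2) : HeisenbergSum := (0, mk (Pi.single i 1) 0 0)
/-- The standard generators `X_{2i}` of the summand `𝔥₅`. -/
def Y' (i : Fin 2) : HeisenbergSum := (0, mk 0 (Pi.single i 1) 0)

theorem ω₁_self (u : HeisenbergSum) : ω₁ u u = 0 := form_self u.1
theorem ω₂_self (u : HeisenbergSum) : ω₂ u u = 0 := form_self u.2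
theorem ω₁_swap (u v : HeisenbergSum) : ω₁ u v = -ω₁ v u := form_swap u.1 v.1
theorem ω₂_swap (u v : HeisenbergSum) : ω₂ u v = -ω₂ v u := form_swap u.2 v.2
theorem ω₁_central_left (s : ℝ × ℝ) (v : HeisenbergSum) : ω₁ (central s) v = 0 := by
  simp [ω₁_apply, central_apply]
theorem ω₂_central_left (s : ℝ × ℝ) (v : HeisenbergSum) : ω₂ (central s) v = 0 := by
  simp [ω₂_apply, central_apply]
theorem ω₁_central_right (s : ℝ × ℝ) (v : HeisenbergSum) : ω₁ v (central s) = 0 := by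
  simp [ω₁_apply, central_apply]
theorem ω₂_central_right (s : ℝ × ℝ) (v : HeisenbergSum) : ω₂ v (central s) = 0 := by
  simp [ω₂_apply, central_apply]

/-- An element in the radical of both forms is central. -/
theorem eq_central_of_forms_eq_zero {u : HeisenbergSum} (h₁ : ∀ v, ω₁ u v = 0)
    (h₂ : ∀ v, ω₂ u v = 0) : u = central (u.1.2.2, u.2.2.2) := by
  have a := h₁ X
  have b := h₁ Y
  have c := h₂ (X' 0)
  have d := h₂ (X' 1)
  have e := h₂ (Y' 0)
  have f := h₂ (Y' 1)
  simp [ω₁_apply, ω₂_apply, X, Y, X', Y'] at a b c d e f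
  refine Prod.ext (ext_iff'.2 ⟨?_, ?_, ?_⟩) (ext_iff'.2 ⟨?_, ?_, ?_⟩)
  · ext i; fin_cases i; simpa [central_apply] using b
  · ext i; fin_cases i; simpa [central_apply] using a
  · simp [central_apply]
  · ext i; fin_cases i <;> simpa [central_apply]
  · ext i; fin_cases i <;> simpa [central_apply]
  · simp [central_apply]

theorem finrank_eq_eight : Module.finrank ℝ HeisenbergSum = 8 := by
  rw [Module.finrank_prod, HeisenbergLie.finrank_eq, HeisenbergLie.finrank_eq]

/-- `ω₁` has rank two. -/
theorem ω₁_pluecker (u v x y : HeisenbergSum) :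
    ω₁ u v * ω₁ x y = ω₁ u x * ω₁ v y - ω₁ u y * ω₁ v x := by
  simp only [ω₁_apply]
  ring

/-- For a form of rank two, the orthogonal complement of a hyperbolic plane is the radical. -/
theorem ω₁_eq_zero_of_orthogonal {x y u : HeisenbergSum} (h : ω₁ x y ≠ 0) (hx : ω₁ u x = 0)
    (hy : ω₁ u y = 0) (v : HeisenbergSum) : ω₁ u v = 0 := by
  have := ω₁_pluecker u v x y
  rw [hx, hy] at this
  simpa [h] using this

/-- The Pfaffian of six vectors with respect to `ω₂` vanishes, as `ω₂` has rank four. -/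
theorem ω₂_eq_zero_of_orthogonal {x y x' y' u : HeisenbergSum} (h : ω₂ x y ≠ 0)
    (h' : ω₂ x' y' ≠ 0) (h1 : ω₂ x x' = 0) (h2 : ω₂ x y' = 0)
    (hx : ω₂ u x = 0) (hy : ω₂ u y = 0)
    (hx' : ω₂ u x' = 0) (hy' : ω₂ u y' = 0) (v : HeisenbergSum) : ω₂ u v = 0 := by
  -- The Pfaffian of the Gram matrix of `u, v, x, y, x', y'`, expanded along the row of `u`. The
  -- hypotheses leave only `ω₂ u v * ω₂ x y * ω₂ x' y'`.
  have key : ω₂ u v * (ω₂ x y * ω₂ x' y' - ω₂ x x' * ω₂ y y' + ω₂ x y' * ω₂ y x')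
      - ω₂ u x * (ω₂ v y * ω₂ x' y' - ω₂ v x' * ω₂ y y' + ω₂ v y' * ω₂ y x')
      + ω₂ u y * (ω₂ v x * ω₂ x' y' - ω₂ v x' * ω₂ x y' + ω₂ v y' * ω₂ x x')
      - ω₂ u x' * (ω₂ v x * ω₂ y y' - ω₂ v y * ω₂ x y' + ω₂ v y' * ω₂ x y)
      + ω₂ u y' * (ω₂ v x * ω₂ y x' - ω₂ v y * ω₂ x x' + ω₂ v x' * ω₂ x y) = 0 := by
    simp only [ω₂_apply]
    ring
  rw [h1, h2, hx, hy, hx', hy'] at key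
  simpa [h, h'] using key

/-! ### Lower central series and type (6, 2) -/

theorem lcs_one : (LieModule.lowerCentralSeries ℝ HeisenbergSum HeisenbergSum 1).toSubmodule =
    LinearMap.range central := by
  rw [LieModule.lowerCentralSeries_succ, LieSubmodule.lieIdeal_oper_eq_linear_span']
  apply le_antisymm
  · rw [Submodule.span_le]
    rintro _ ⟨x, -, y, -, rfl⟩
    exact ⟨_, (lie_eq_central x y).symm⟩
  · rintro _ ⟨⟨s, t⟩, rfl⟩
    -- Every central element is a single bracket: the cross terms between the two summands vanish.
    refine Submodule.subset_span ⟨s • X + t • X' 0, trivial, Y + Y' 0, trivial, ?_⟩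
    rw [lie_eq_central]
    congr 1
    ext <;> simp [ω₁_apply, ω₂_apply, X, X', Y, Y']

theorem lcs_two : LieModule.lowerCentralSeries ℝ HeisenbergSum HeisenbergSum 2 = ⊥ := by
  rw [← LieSubmodule.toSubmodule_eq_bot, LieModule.lowerCentralSeries_succ,
    LieSubmodule.lieIdeal_oper_eq_linear_span', Submodule.span_eq_bot]
  rintro _ ⟨x, -, y, hy, rfl⟩
  obtain ⟨s, rfl⟩ : y ∈ LinearMap.range central := lcs_one ▸ hy
  rw [lie_eq_central, ω₁_central_right, ω₂_central_right]
  exact map_zero central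

theorem finrank_lcs_one :
    Module.finrank ℝ (LieModule.lowerCentralSeries ℝ HeisenbergSum HeisenbergSum 1).toSubmodule
      = 2 := by
  rw [lcs_one, LinearMap.finrank_range_of_inj central_injective]
  simp

theorem hasNilpotentType : HasNilpotentType ℝ HeisenbergSum [6, 2] := by
  have hne : LieModule.lowerCentralSeries ℝ HeisenbergSum HeisenbergSum 1 ≠ ⊥ := by
    intro h
    have := finrank_lcs_one
    rw [h] at this
    simp at this
  have hq (M N : Submodule ℝ HeisenbergSum) (h : N ≤ M) :
      Module.finrank ℝ (M ⧸ N.submoduleOf M) + Module.finrank ℝ N = Module.finrank ℝ M := by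
    rw [← (Submodule.submoduleOfEquivOfLe h).finrank_eq]
    exact Submodule.finrank_quotient_add_finrank _
  refine ⟨lcs_two, fun s hs => ?_, fun i => ?_⟩
  · have : s = 0 ∨ s = 1 := by
      simp at hs
      omega
    rcases this with rfl | rfl
    · intro h
      exact hne (le_bot_iff.1 (h ▸ LieModule.antitone_lowerCentralSeries ℝ _ _ zero_le_one))
    · exact hne
  · have h8 : Module.finrank ℝ
        (LieModule.lowerCentralSeries ℝ HeisenbergSum HeisenbergSum 0).toSubmodule = 8 := by
      rw [LieModule.lowerCentralSeries_zero, LieSubmodule.top_toSubmodule, finrank_top,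
        finrank_eq_eight]
    have h0 : Module.finrank ℝ
        (LieModule.lowerCentralSeries ℝ HeisenbergSum HeisenbergSum 2).toSubmodule = 0 := by
      rw [lcs_two]
      simp
    have anti (j : ℕ) : (LieModule.lowerCentralSeries ℝ HeisenbergSum HeisenbergSum
        (j + 1)).toSubmodule ≤
        (LieModule.lowerCentralSeries ℝ HeisenbergSum HeisenbergSum j).toSubmodule :=
      LieModule.antitone_lowerCentralSeries ℝ _ _ (Nat.le_succ j)
    have q0 := hq _ _ (anti 0)
    have q1 := hq _ _ (anti 1)
    rw [h8, finrank_lcs_one] at q0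
    rw [finrank_lcs_one, h0] at q1
    match i with
    | ⟨0, _⟩ => exact Nat.add_right_cancel q0
    | ⟨1, _⟩ => exact q1

end HeisenbergSum

/-! ### The orbit of `x y²` -/

section BinaryCubic

open MvPolynomial

/-- The binary cubic form with the given coefficients. -/
noncomputable def binaryCubic {K : Type*} [CommSemiring K] (a b c d : K) :
    MvPolynomial (Fin 2) K :=
  C a * X 0 ^ 3 + C b * (X 0 ^ 2 * X 1) + C c * (X 0 * X 1 ^ 2) + C d * X 1 ^ 3

theorem coeff_binaryCubic {K : Type*} [CommSemiring K] (a b c d : K) :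
    coeff (Finsupp.single 0 3) (binaryCubic a b c d) = a ∧
    coeff (Finsupp.single 0 2 + Finsupp.single 1 1) (binaryCubic a b c d) = b ∧
    coeff (Finsupp.single 0 1 + Finsupp.single 1 2) (binaryCubic a b c d) = c ∧
    coeff (Finsupp.single 1 3) (binaryCubic a b c d) = d := by
  have h : binaryCubic a b c d = monomial (Finsupp.single 0 3) a +
      monomial (Finsupp.single 0 2 + Finsupp.single 1 1) b +
      monomial (Finsupp.single 0 1 + Finsupp.single 1 2) c + monomial (Finsupp.single 1 3) d := by
    simp [binaryCubic, monomial_eq, Finsupp.prod_add_index', pow_add]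
  have ne {s t : Fin 2 →₀ ℕ} (h : s 0 ≠ t 0) : s ≠ t := fun e => h (e ▸ rfl)
  rw [h]
  refine ⟨?_, ?_, ?_, ?_⟩ <;> simp only [coeff_add, coeff_monomial] <;>
    rw [if_neg (ne (by simp)), if_neg (ne (by simp)), if_neg (ne (by simp))] <;> simp

/-- The action substitutes by `A⁻¹`, so it is the rows of `A⁻¹` that give the linear factors in `(a
x + b y) (c x + d y)²`. -/
theorem formAct_cubicXYY {K : Type*} [Field K] (A : GL (Fin 2) K) {a b c d : K}
    (h : ((A⁻¹ : GL (Fin 2) K) : Matrix (Fin 2) (Fin 2) K) = !![a, b; c, d]) :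
    formAct A (cubicXYY K) = binaryCubic (a * c ^ 2) (b * c ^ 2 + 2 * a * c * d)
      (a * d ^ 2 + 2 * b * c * d) (b * d ^ 2) := by
  have e (i j) : (A⁻¹ : GL (Fin 2) K) i j = !![a, b; c, d] i j := by rw [← h]
  simp only [formAct, cubicXYY, map_mul, map_pow, aeval_X, Fin.sum_univ_two, e, binaryCubic]
  simp [map_ofNat (C (R := K) (σ := Fin 2)) 2]
  ring

theorem exists_GL_inv_eq {K : Type*} [Field K] {a b c d : K} (h : a * d - b * c ≠ 0) :
    ∃ A : GL (Fin 2) K, ((A⁻¹ : GL (Fin 2) K) : Matrix (Fin 2) (Fin 2) K) = !![a, b; c, d] :=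
  ⟨(Matrix.GeneralLinearGroup.mkOfDetNeZero !![a, b; c, d] (by rwa [Matrix.det_fin_two_of]))⁻¹,
    by rw [inv_inv]; rfl⟩

/-- If a product `(a x + b y) (c x + d y)²` of real linear forms, the two factors being
independent, has rational coefficients, then it is also such a product with rational factors. -/
theorem exists_rat_factors {a b c d : ℝ} (h : a * d - b * c ≠ 0) {k₀ k₁ k₂ k₃ : ℚ}
    (h₀ : (k₀ : ℝ) = a * c ^ 2) (h₁ : (k₁ : ℝ) = b * c ^ 2 + 2 * a * c * d)
    (h₂ : (k₂ : ℝ) = a * d ^ 2 + 2 * b * c * d) (h₃ : (k₃ : ℝ) = b * d ^ 2) :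
    ∃ a' b' c' d' : ℚ, a' * d' - b' * c' ≠ 0 ∧ k₀ = a' * c' ^ 2 ∧
      k₁ = b' * c' ^ 2 + 2 * a' * c' * d' ∧ k₂ = a' * d' ^ 2 + 2 * b' * c' * d' ∧
      k₃ = b' * d' ^ 2 := by
  by_cases hc : c = 0
  · subst hc
    have hd : d ≠ 0 := by rintro rfl; simp at h
    have ha : a ≠ 0 := by rintro rfl; simp at h
    have e₀ : k₀ = 0 := by exact_mod_cast (by simpa using h₀ : (k₀ : ℝ) = 0)
    have e₁ : k₁ = 0 := by exact_mod_cast (by simpa using h₁ : (k₁ : ℝ) = 0)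
    refine ⟨k₂, k₃, 0, 1, ?_, by simp [e₀], by simp [e₁], by simp, by simp⟩
    have : (k₂ : ℝ) ≠ 0 := by
      rw [h₂]
      simp [ha, hd]
    simpa using (by exact_mod_cast this : k₂ ≠ 0)
  · -- the quotient `d / c` is read off from the Hessian
    have hH : ((k₁ ^ 2 - 3 * k₀ * k₂ : ℚ) : ℝ) = c ^ 2 * (a * d - b * c) ^ 2 := by
      push_cast
      rw [h₀, h₁, h₂]
      ring
    have hH0 : c ^ 2 * (a * d - b * c) ^ 2 ≠ 0 := by positivity
    obtain ⟨e, he⟩ : ∃ e : ℚ, (e : ℝ) = d / c := by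
      -- Up to a constant the Hessian is `(k₁² - 3k₀k₂) x² + (k₁k₂ - 9k₀k₃) x y + (k₂² - 3k₁k₃) y²`,
      -- which here equals `(ad - bc)² (c x + d y)²`. Half the ratio of its first two coefficients
      -- is `d / c`.
      refine ⟨(k₁ * k₂ - 9 * k₀ * k₃) / (2 * (k₁ ^ 2 - 3 * k₀ * k₂)), ?_⟩
      rw [Rat.cast_div, Rat.cast_mul, hH]
      push_cast
      rw [h₀, h₁, h₂, h₃]
      field_simp
      ring
    have hd : d = e * c := by rw [he]; field_simp
    subst hd
    -- Normalize the double factor to `x + e y` and move `c²` into the simple factor, whose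
    -- coefficients become `a c² = k₀` and `b c² = k₁ - 2 k₀ e`.
    refine ⟨k₀, k₁ - 2 * k₀ * e, 1, e, ?_, by ring, by ring, ?_, ?_⟩
    · have : ((k₀ * e - (k₁ - 2 * k₀ * e) * 1 : ℚ) : ℝ) = c * (a * (e * c) - b * c) := by
        push_cast
        rw [h₀, h₁]
        ring
      intro h0
      rw [h0, Rat.cast_zero] at this
      exact mul_ne_zero hc h this.symm
    · have : (k₂ : ℝ) = k₀ * e ^ 2 + 2 * (k₁ - 2 * k₀ * e) * 1 * e := by
        rw [h₀, h₁, h₂]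
        ring
      exact_mod_cast this
    · have : (k₃ : ℝ) = (k₁ - 2 * k₀ * e) * e ^ 2 := by
        rw [h₀, h₁, h₃]
        ring
      exact_mod_cast this

theorem map_binaryCubic (a b c d : ℚ) :
    MvPolynomial.map (algebraMap ℚ ℝ) (binaryCubic a b c d) =
      binaryCubic (algebraMap ℚ ℝ a) (algebraMap ℚ ℝ b) (algebraMap ℚ ℝ c) (algebraMap ℚ ℝ d) := by
  simp [binaryCubic]

theorem formOrbit_cubicXYY_inter_rational :
    formOrbit (cubicXYY ℝ) ∩ Set.range (MvPolynomial.map (algebraMap ℚ ℝ)) =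
      MvPolynomial.map (algebraMap ℚ ℝ) '' formOrbit (cubicXYY ℚ) := by
  apply Set.Subset.antisymm
  · rintro _ ⟨⟨A, rfl⟩, g, hg⟩
    set B : Matrix (Fin 2) (Fin 2) ℝ := ((A⁻¹ : GL (Fin 2) ℝ) : Matrix (Fin 2) (Fin 2) ℝ) with hB
    have hdet : B 0 0 * B 1 1 - B 0 1 * B 1 0 ≠ 0 := by
      rw [← Matrix.det_fin_two]
      exact (Matrix.GeneralLinearGroup.det A⁻¹).ne_zero
    have hact := formAct_cubicXYY A (Matrix.eta_fin_two B)
    simp only at hg ⊢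
    rw [hact] at hg ⊢
    obtain ⟨e₀, e₁, e₂, e₃⟩ := coeff_binaryCubic (B 0 0 * B 1 0 ^ 2)
      (B 0 1 * B 1 0 ^ 2 + 2 * B 0 0 * B 1 0 * B 1 1)
      (B 0 0 * B 1 1 ^ 2 + 2 * B 0 1 * B 1 0 * B 1 1) (B 0 1 * B 1 1 ^ 2)
    rw [← hg, coeff_map] at e₀ e₁ e₂ e₃
    obtain ⟨a, b, c, d, h, h₀, h₁, h₂, h₃⟩ := exists_rat_factors hdet e₀ e₁ e₂ e₃
    obtain ⟨A', hA'⟩ := exists_GL_inv_eq h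
    refine ⟨_, ⟨A', rfl⟩, ?_⟩
    simp only
    rw [formAct_cubicXYY A' hA', map_binaryCubic, ← h₀, ← h₁, ← h₂, ← h₃,
      e₀, e₁, e₂, e₃]
  · rintro _ ⟨_, ⟨A, rfl⟩, rfl⟩
    refine ⟨?_, _, rfl⟩
    set B : Matrix (Fin 2) (Fin 2) ℚ := ((A⁻¹ : GL (Fin 2) ℚ) : Matrix (Fin 2) (Fin 2) ℚ) with hB
    have hdet : B 0 0 * B 1 1 - B 0 1 * B 1 0 ≠ 0 := by
      rw [← Matrix.det_fin_two]
      exact (Matrix.GeneralLinearGroup.det A⁻¹).ne_zero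
    have hdet' : (B 0 0 : ℝ) * B 1 1 - B 0 1 * B 1 0 ≠ 0 := by exact_mod_cast hdet
    obtain ⟨A', hA'⟩ := exists_GL_inv_eq hdet'
    refine ⟨A', ?_⟩
    simp only
    rw [formAct_cubicXYY A' hA', formAct_cubicXYY A (Matrix.eta_fin_two B), map_binaryCubic]
    simp

end BinaryCubic

/-! ### Linear algebra over a rational form -/

namespace HeisenbergSum

open HeisenbergLie Matrix

/-- A family in a rational form which is linearly independent over `ℚ` is so over `ℝ`. -/
theorem linearIndependent_coe {N : LieSubalgebra ℚ HeisenbergSum} (hN : IsRationalForm N)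
    {ι : Type*} {v : ι → N} (hv : LinearIndependent ℚ v) :
    LinearIndependent ℝ (fun i => (v i : HeisenbergSum)) := by
  -- `finrank` is 0 for infinite-dimensional spaces, so its being positive gives finiteness.
  have hpos : 0 < Module.finrank ℚ N := by
    rw [hN.finrank_eq, finrank_eq_eight]
    norm_num
  have : Module.Finite ℚ N := Module.finite_of_finrank_pos hpos
  let B := Module.Basis.sumExtend hv
  have : Fintype (ι ⊕ Module.Basis.sumExtendIndex hv) := Module.Basis.fintypeIndexOfRankLtAleph0 B
    (Module.rank_lt_aleph0 ℚ N)
  -- A `ℚ`-basis of `N` spans over `ℝ` and has as many elements as the real dimension, hence is a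
  -- real basis.
  have hB : LinearIndependent ℝ (fun i => (B i : HeisenbergSum)) := by
    apply linearIndependent_of_top_le_span_of_card_eq_finrank
    · rw [← hN.span_eq_top, Submodule.span_le]
      intro x hx
      have hx' : (⟨x, hx⟩ : N) ∈ Submodule.span ℚ (Set.range B) := by
        rw [B.span_eq]
        trivial
      have := Submodule.mem_map_of_mem (f := N.toSubmodule.subtype) hx'
      rw [Submodule.map_span, ← Set.range_comp] at this
      exact Submodule.span_le_restrictScalars ℚ ℝ _ this
    · rw [← Module.finrank_eq_card_basis B, hN.finrank_eq]
  have := hB.comp Sum.inl Sum.inl_injective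
  convert this using 2 with i
  simp only [B, Module.Basis.sumExtend, Module.Basis.coe_reindex, Function.comp_apply,
    Module.Basis.extend_apply_self]
  rfl

/-- The form `ω` takes rational values on `N`. -/
def IsRationalOn (N : LieSubalgebra ℚ HeisenbergSum)
    (ω : HeisenbergSum →ₗ[ℝ] HeisenbergSum →ₗ[ℝ] ℝ) : Prop :=
  ∀ u ∈ N, ∀ v ∈ N, ∃ q : ℚ, (q : ℝ) = ω u v

/-- A bilinear form that vanishes on a rational form is zero. -/
theorem eq_zero_of_forall_mem {N : LieSubalgebra ℚ HeisenbergSum} (hN : IsRationalForm N)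
    {ω : HeisenbergSum →ₗ[ℝ] HeisenbergSum →ₗ[ℝ] ℝ} (h : ∀ u ∈ N, ∀ v ∈ N, ω u v = 0) : ω = 0 :=
  LinearMap.ext_on hN.span_eq_top fun u hu => LinearMap.ext_on hN.span_eq_top fun v hv => h u hu v hv

theorem smul_mem_of_rat {N : LieSubalgebra ℚ HeisenbergSum} {u : HeisenbergSum} (hu : u ∈ N)
    (q : ℚ) : (q : ℝ) • u ∈ N := by
  rw [Rat.cast_smul_eq_qsmul]
  exact N.smul_mem q hu

/-! ### Gram matrices modulo the center and rational eigenvalues -/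

/-- The coordinates modulo the center. -/
def toVec : HeisenbergSum →ₗ[ℝ] Fin 6 → ℝ where
  toFun u := ![u.1.1 0, u.1.2.1 0, u.2.1 0, u.2.2.1 0, u.2.1 1, u.2.2.1 1]
  map_add' u v := by
    ext i; fin_cases i <;> simp
  map_smul' t u := by
    ext i; fin_cases i <;> simp

theorem toVec_apply (u : HeisenbergSum) :
    toVec u = ![u.1.1 0, u.1.2.1 0, u.2.1 0, u.2.2.1 0, u.2.1 1, u.2.2.1 1] := rfl

theorem toVec_surjective : Function.Surjective toVec := fun w =>
  ⟨(mk ![w 0] ![w 1] 0, mk ![w 2, w 4] ![w 3, w 5] 0), by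
    ext i; fin_cases i <;> simp [toVec_apply]⟩

/-- The Gram matrix of `a • ω₁ + b • ω₂` in the standard coordinates modulo the center. -/
def gram (a b : ℝ) : Matrix (Fin 6) (Fin 6) ℝ :=
  !![0, a, 0, 0, 0, 0; -a, 0, 0, 0, 0, 0; 0, 0, 0, b, 0, 0; 0, 0, -b, 0, 0, 0;
    0, 0, 0, 0, 0, b; 0, 0, 0, 0, -b, 0]

theorem form_eq_gram (a b : ℝ) (u v : HeisenbergSum) :
    (a • ω₁ + b • ω₂) u v = toVec u ⬝ᵥ gram a b *ᵥ toVec v := by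
  simp [ω₁_apply, ω₂_apply, toVec_apply, gram, Matrix.mulVec, dotProduct, Fin.sum_univ_succ]
  ring

/-- The relative matrix of two combinations of `ω₁` and `ω₂` is diagonal, with one eigenvalue twice
and the other four times. -/
theorem gram_mul_diagonal (a b r s : ℝ) :
    gram a b * Matrix.diagonal ![r, r, s, s, s, s] = gram (a * r) (b * s) := by
  ext i j
  rw [Matrix.mul_diagonal]
  fin_cases i <;> fin_cases j <;> simp [gram]

theorem det_gram_ne_zero {a b : ℝ} (ha : a ≠ 0) (hb : b ≠ 0) : (gram a b).det ≠ 0 := by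
  have h : gram a b * gram (-a⁻¹) (-b⁻¹) = 1 := by
    ext i j
    fin_cases i <;> fin_cases j <;> simp [gram, Matrix.mul_apply, Fin.sum_univ_succ, ha, hb]
  intro h0
  have := congrArg Matrix.det h
  simp [Matrix.det_mul, h0] at this

theorem exists_basis_mod_center {N : LieSubalgebra ℚ HeisenbergSum} (hN : IsRationalForm N) :
    ∃ u : Fin 6 → HeisenbergSum, (∀ i, u i ∈ N) ∧
      (Matrix.of fun i => toVec (u i)).det ≠ 0 := by
  have hspan : Submodule.span ℝ (toVec '' (N : Set HeisenbergSum)) = ⊤ := by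
    rw [← Submodule.map_span, hN.span_eq_top, Submodule.map_top,
      LinearMap.range_eq_top.2 toVec_surjective]
  have h6 : Module.finrank ℝ (Submodule.span ℝ (toVec '' (N : Set HeisenbergSum))) = 6 := by
    rw [hspan]
    simp
  obtain ⟨f, hf, -, hli⟩ := Submodule.exists_fun_fin_finrank_span_eq ℝ
    (toVec '' (N : Set HeisenbergSum))
  choose u hu hfu using hf
  refine ⟨fun i => u (Fin.cast h6.symm i), fun i => hu _, ?_⟩
  have hli' := hli.comp (Fin.cast h6.symm) (Fin.cast_injective _)
  rw [← isUnit_iff_ne_zero, ← Matrix.isUnit_iff_isUnit_det,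
    ← Matrix.linearIndependent_rows_iff_isUnit]
  have e : (fun i => toVec (u (Fin.cast h6.symm i))) = f ∘ Fin.cast h6.symm :=
    funext fun i => hfu _
  rw [← e] at hli'
  exact hli'

/-- With mean `m = p₁ / 6` and `d = (r - s) / 3`, one has `r = m + 2d` and `s = m - d`. The second
and third central moments are `12 d²` and `12 d³`, so `d` is their quotient. With equal
multiplicities the third moment would vanish and only `d²` would be known to be rational. -/
theorem exists_rat_of_power_sums {r s : ℝ} {p₁ p₂ p₃ : ℚ} (h₁ : (p₁ : ℝ) = 2 * r + 4 * s)
    (h₂ : (p₂ : ℝ) = 2 * r ^ 2 + 4 * s ^ 2) (h₃ : (p₃ : ℝ) = 2 * r ^ 3 + 4 * s ^ 3) :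
    (∃ q : ℚ, (q : ℝ) = r) ∧ ∃ q : ℚ, (q : ℝ) = s := by
  obtain ⟨d, hd⟩ : ∃ d : ℚ, (d : ℝ) = (r - s) / 3 := by
    by_cases hrs : r = s
    · exact ⟨0, by simp [hrs]⟩
    have hrs' : r - s ≠ 0 := sub_ne_zero.2 hrs
    refine ⟨(p₃ - 6 * (p₁ / 6) ^ 3 - 36 * (p₁ / 6) * ((p₂ - 6 * (p₁ / 6) ^ 2) / 12)) / 12 /
      ((p₂ - 6 * (p₁ / 6) ^ 2) / 12), ?_⟩
    push_cast
    have e : ((p₂ : ℝ) - 6 * (p₁ / 6) ^ 2) / 12 = ((r - s) / 3) ^ 2 := by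
      rw [h₁, h₂]
      ring
    rw [e, div_eq_iff (by positivity), h₁, h₃]
    ring
  refine ⟨⟨p₁ / 6 + 2 * d, ?_⟩, ⟨p₁ / 6 - d, ?_⟩⟩
  · push_cast
    rw [h₁, hd]
    ring
  · push_cast
    rw [h₁, hd]
    ring

/-- On vectors of `N` forming a basis modulo the center, the Gram matrices `G` and `H` of the two
forms are rational. The matrix `T = G⁻¹ H` is conjugate over `ℝ` to `diag(r, r, s, s, s, s)`, so the
power sums of the eigenvalues are traces of rational matrices. -/
theorem rational_ratios {N : LieSubalgebra ℚ HeisenbergSum} (hN : IsRationalForm N)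
    {a b r s : ℝ} (ha : a ≠ 0) (hb : b ≠ 0) (hp : IsRationalOn N (a • ω₁ + b • ω₂))
    (hq : IsRationalOn N ((a * r) • ω₁ + (b * s) • ω₂)) :
    (∃ q : ℚ, (q : ℝ) = r) ∧ ∃ q : ℚ, (q : ℝ) = s := by
  obtain ⟨u, hu, hdet⟩ := exists_basis_mod_center hN
  set P : Matrix (Fin 6) (Fin 6) ℝ := Matrix.of fun i => toVec (u i) with hP
  choose G hG using fun i j => hp (u i) (hu i) (u j) (hu j)
  choose H hH using fun i j => hq (u i) (hu i) (u j) (hu j)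
  set φ := algebraMap ℚ ℝ
  set D : Matrix (Fin 6) (Fin 6) ℝ := Matrix.diagonal ![r, r, s, s, s, s] with hD
  have hG' : φ.mapMatrix (Matrix.of G) = P * gram a b * Pᵀ := by
    ext i j
    rw [Matrix.mul_mul_apply, Matrix.transpose_transpose]
    exact (hG i j).trans (form_eq_gram ..)
  have hH' : φ.mapMatrix (Matrix.of H) = P * gram a b * D * Pᵀ := by
    ext i j
    rw [Matrix.mul_assoc P, hD, gram_mul_diagonal, Matrix.mul_mul_apply,
      Matrix.transpose_transpose]
    exact (hH i j).trans (form_eq_gram ..)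
  have hPt : IsUnit Pᵀ.det := by rwa [Matrix.det_transpose, isUnit_iff_ne_zero]
  have hGd : (φ.mapMatrix (Matrix.of G)).det ≠ 0 := by
    rw [hG', Matrix.det_mul, Matrix.det_mul, Matrix.det_transpose]
    exact mul_ne_zero (mul_ne_zero hdet (det_gram_ne_zero ha hb)) hdet
  have hGu : IsUnit (Matrix.of G).det := by
    rw [isUnit_iff_ne_zero]
    intro h
    rw [← RingHom.map_det, h, map_zero] at hGd
    exact hGd rfl
  set T := (Matrix.of G)⁻¹ * Matrix.of H with hT
  have hGT : Matrix.of G * T = Matrix.of H := Matrix.mul_nonsing_inv_cancel_left _ _ hGu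
  have hTD : Pᵀ * φ.mapMatrix T = D * Pᵀ := by
    have h := congrArg φ.mapMatrix hGT
    rw [map_mul, hG', hH', Matrix.mul_assoc, Matrix.mul_assoc _ D] at h
    have hu' : IsUnit (P * gram a b).det := by
      rw [Matrix.det_mul, isUnit_iff_ne_zero]
      exact mul_ne_zero hdet (det_gram_ne_zero ha hb)
    exact (Matrix.isUnit_iff_isUnit_det _).2 hu' |>.mul_left_cancel h
  have hpow (n : ℕ) : Pᵀ * φ.mapMatrix T ^ n = D ^ n * Pᵀ := by
    induction n with
    | zero => simp
    | succ n ih => rw [pow_succ, ← Matrix.mul_assoc, ih, Matrix.mul_assoc, hTD, ← Matrix.mul_assoc,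
        ← pow_succ]
  have htr (n : ℕ) : ((Matrix.trace (T ^ n) : ℚ) : ℝ) = 2 * r ^ n + 4 * s ^ n := by
    have h1 : ((Matrix.trace (T ^ n) : ℚ) : ℝ) = Matrix.trace (φ.mapMatrix T ^ n) := by
      rw [← map_pow]
      exact AddMonoidHom.map_trace φ (T ^ n)
    have h2 : φ.mapMatrix T ^ n = Pᵀ⁻¹ * (D ^ n * Pᵀ) := by
      rw [← hpow, Matrix.nonsing_inv_mul_cancel_left _ _ hPt]
    rw [h1, h2, Matrix.trace_mul_comm, Matrix.mul_nonsing_inv_cancel_right _ _ hPt, hD,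
      Matrix.diagonal_pow, Matrix.trace_diagonal]
    simp [Fin.sum_univ_succ]
    ring
  exact exists_rat_of_power_sums (by simpa using htr 1) (htr 2) (htr 3)

/-! ### Rationality of each bracket form up to a factor -/

variable {N : LieSubalgebra ℚ HeisenbergSum}

theorem ω₁_ne_zero : ω₁ ≠ 0 := fun h => by
  have := LinearMap.congr_fun₂ h X Y
  simp [ω₁_apply, X, Y] at this

theorem ω₂_ne_zero : ω₂ ≠ 0 := fun h => by
  have := LinearMap.congr_fun₂ h (X' 0) (Y' 0)
  simp [ω₂_apply, X', Y'] at this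

/-- Otherwise `ω₁ u v • ω₂ - ω₂ u v • ω₁` vanishes on `N`, hence everywhere. Evaluating it where `ω₁
= 0` and `ω₂ = 1` makes `ω₁` vanish on `N`, a contradiction. -/
theorem exists_forms_det_ne_zero (hN : IsRationalForm N) :
    ∃ u ∈ N, ∃ v ∈ N, ∃ u' ∈ N, ∃ v' ∈ N, ω₁ u v * ω₂ u' v' - ω₂ u v * ω₁ u' v' ≠ 0 := by
  by_contra! h
  refine ω₁_ne_zero (eq_zero_of_forall_mem hN fun u hu v hv => ?_)
  have h0 : ω₁ u v • ω₂ - ω₂ u v • ω₁ = 0 :=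
    eq_zero_of_forall_mem hN fun u' hu' v' hv' => by simpa using h u hu v hv u' hu' v' hv'
  have := LinearMap.congr_fun₂ h0 (X' 0) (Y' 0)
  simpa [ω₁_apply, ω₂_apply, X', Y'] using this

/-- The center of a rational form is a rational form of the center. -/
theorem exists_rat_coordinates (hN : IsRationalForm N) {r s t : ℝ × ℝ} (hr : central r ∈ N)
    (hs : central s ∈ N) (ht : central t ∈ N) (hst : s.1 * t.2 - s.2 * t.1 ≠ 0) :
    ∃ p q : ℚ, r = (p : ℝ) • s + (q : ℝ) • t := by
  have hli : LinearIndependent ℚ ![(⟨central s, hs⟩ : N), ⟨central t, ht⟩] := by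
    rw [LinearIndependent.pair_iff]
    intro a b hab
    have e := congrArg (N.toSubmodule.subtype) hab
    simp only [map_add, map_smul, map_zero, Submodule.subtype_apply] at e
    rw [← Rat.cast_smul_eq_qsmul ℝ a, ← Rat.cast_smul_eq_qsmul ℝ b, ← map_smul, ← map_smul,
      ← map_add, map_eq_zero_iff _ central_injective] at e
    have e1 : a * s.1 + b * t.1 = 0 := congrArg Prod.fst e
    have e2 : a * s.2 + b * t.2 = 0 := congrArg Prod.snd e
    have a0 : (a : ℝ) * (s.1 * t.2 - s.2 * t.1) = 0 := by linear_combination t.2 * e1 - t.1 * e2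
    have b0 : (b : ℝ) * (s.1 * t.2 - s.2 * t.1) = 0 := by linear_combination s.1 * e2 - s.2 * e1
    exact ⟨by simpa [hst] using a0, by simpa [hst] using b0⟩
  have hmem : (⟨central r, hr⟩ : N) ∈
      Submodule.span ℚ (Set.range ![(⟨central s, hs⟩ : N), ⟨central t, ht⟩]) := by
    -- Three central vectors of `N` independent over `ℚ` would be independent over `ℝ`, but the
    -- center is a plane.
    by_contra hnot
    have h3 := linearIndependent_coe hN (linearIndependent_finCons.2 ⟨hli, hnot⟩)
    have e : (fun i => ((Fin.cons (⟨central r, hr⟩ : N)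
        ![(⟨central s, hs⟩ : N), ⟨central t, ht⟩] : Fin 3 → N) i : HeisenbergSum)) =
        central ∘ ![r, s, t] := by
      ext i : 1
      fin_cases i <;> rfl
    have := (LinearIndependent.of_comp central (e ▸ h3)).fintype_card_le_finrank
    simp at this
  rw [Matrix.range_cons_cons_empty, Submodule.mem_span_pair] at hmem
  obtain ⟨p, q, hpq⟩ := hmem
  refine ⟨p, q, central_injective ?_⟩
  have e := congrArg (N.toSubmodule.subtype) hpq
  simp only [map_add, map_smul, Submodule.subtype_apply] at e
  rw [map_add, map_smul, map_smul, Rat.cast_smul_eq_qsmul, Rat.cast_smul_eq_qsmul]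
  exact e.symm

theorem IsRationalOn.add_smul {ω ω' : HeisenbergSum →ₗ[ℝ] HeisenbergSum →ₗ[ℝ] ℝ}
    (h : IsRationalOn N ω) (h' : IsRationalOn N ω') (q : ℚ) :
    IsRationalOn N (ω + (q : ℝ) • ω') := fun u hu v hv => by
  obtain ⟨a, ha⟩ := h u hu v hv
  obtain ⟨b, hb⟩ := h' u hu v hv
  exact ⟨a + q * b, by simp [ha, hb]⟩

/-- Each of the two affine functions of `n` is not identically zero, so it has at most one root; one
of `0, 1, 2` avoids both. -/
theorem exists_rat_shift {a b a' b' : ℝ} (h : a * b' - a' * b ≠ 0) :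
    ∃ n : ℚ, a + n * a' ≠ 0 ∧ b + n * b' ≠ 0 := by
  by_contra! hn
  have ha : ¬ (a = 0 ∧ a' = 0) := by
    rintro ⟨rfl, rfl⟩
    simp at h
  have hb : ¬ (b = 0 ∧ b' = 0) := by
    rintro ⟨rfl, rfl⟩
    simp at h
  have h0 := hn 0
  have h1 := hn 1
  have h2 := hn 2
  push_cast at h0 h1 h2
  by_cases e0 : a + 0 * a' = 0 <;> by_cases e1 : a + 1 * a' = 0 <;>
    by_cases e2 : a + 2 * a' = 0 <;>
    first
    | exact ha ⟨by linarith, by linarith⟩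
    | (simp only [ne_eq, e0, e1, e2, not_false_eq_true, forall_const] at h0 h1 h2
       exact hb ⟨by linarith, by linarith⟩)

/-- Up to a real factor, each of the two bracket forms is rational on a given rational form. -/
theorem exists_smul_isRationalOn (hN : IsRationalForm N) :
    ∃ c₁ c₂ : ℝ, c₁ ≠ 0 ∧ c₂ ≠ 0 ∧ IsRationalOn N (c₁ • ω₁) ∧ IsRationalOn N (c₂ • ω₂) := by
  obtain ⟨u, hu, v, hv, u', hu', v', hv', hdet⟩ := exists_forms_det_ne_zero hN
  have hs : central (ω₁ u v, ω₂ u v) ∈ N := lie_eq_central u v ▸ N.lie_mem hu hv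
  have ht : central (ω₁ u' v', ω₂ u' v') ∈ N := lie_eq_central u' v' ▸ N.lie_mem hu' hv'
  generalize ω₁ u v = s₁, ω₂ u v = s₂, ω₁ u' v' = t₁, ω₂ u' v' = t₂ at hs ht hdet
  have coords (x) (hx : x ∈ N) (y) (hy : y ∈ N) :
      ∃ p q : ℚ, ω₁ x y = p * s₁ + q * t₁ ∧ ω₂ x y = p * s₂ + q * t₂ := by
    obtain ⟨p, q, h⟩ := exists_rat_coordinates hN (lie_eq_central x y ▸ N.lie_mem hx hy) hs ht hdet
    exact ⟨p, q, congrArg Prod.fst h, congrArg Prod.snd h⟩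
  set δ := s₁ * t₂ - s₂ * t₁ with hδ
  obtain ⟨a, b, a', b', hab, hp, hq⟩ : ∃ a b a' b' : ℝ, a * b' - a' * b ≠ 0 ∧
      IsRationalOn N (a • ω₁ + b • ω₂) ∧ IsRationalOn N (a' • ω₁ + b' • ω₂) := by
    -- Cramer's rule: these two forms return the rational coordinates `p` and `q` of a bracket in
    -- the basis `(s₁, s₂)`, `(t₁, t₂)` of the center.
    refine ⟨t₂ / δ, -t₁ / δ, -s₂ / δ, s₁ / δ, ?_, fun x hx y hy => ?_, fun x hx y hy => ?_⟩
    · have : t₂ / δ * (s₁ / δ) - -s₂ / δ * (-t₁ / δ) = δ⁻¹ := by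
        field_simp
        rw [hδ]
        ring
      rw [this]
      exact inv_ne_zero hdet
    · obtain ⟨p, q, h1, h2⟩ := coords x hx y hy
      refine ⟨p, ?_⟩
      simp only [LinearMap.add_apply, LinearMap.smul_apply, smul_eq_mul, h1, h2]
      field_simp
      rw [hδ]
      ring
    · obtain ⟨p, q, h1, h2⟩ := coords x hx y hy
      refine ⟨q, ?_⟩
      simp only [LinearMap.add_apply, LinearMap.smul_apply, smul_eq_mul, h1, h2]
      field_simp
      rw [hδ]
      ring
  obtain ⟨n, hA, hB⟩ := exists_rat_shift hab
  have hp' : IsRationalOn N ((a + n * a') • ω₁ + (b + n * b') • ω₂) := by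
    convert hp.add_smul hq n using 1
    module
  generalize hA' : a + n * a' = A at hA hp'
  generalize hB' : b + n * b' = B at hB hp'
  have hAB : A * b' - a' * B ≠ 0 := by
    convert hab using 1
    rw [← hA', ← hB']
    ring
  obtain ⟨⟨r, hr⟩, ⟨s, hs⟩⟩ := rational_ratios hN (r := a' / A) (s := b' / B) hA hB hp' (by
    rwa [mul_div_cancel₀ _ hA, mul_div_cancel₀ _ hB])
  -- Subtracting `s` times the first form from the second cancels `ω₂`, since `b' = s * B`;
  -- subtracting `r` times it cancels `ω₁`, since `a' = r * A`.
  refine ⟨a' - s * A, b' - r * B, ?_, ?_, ?_, ?_⟩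
  · rw [hs]
    contrapose! hAB
    field_simp at hAB
    linear_combination -hAB
  · rw [hr]
    contrapose! hAB
    field_simp at hAB
    linear_combination hAB
  · convert hq.add_smul hp' (-s) using 1
    have : b' = s * B := by rw [hs]; field_simp
    rw [this]
    push_cast
    module
  · convert hq.add_smul hp' (-r) using 1
    have : a' = r * A := by rw [hr]; field_simp
    rw [this]
    push_cast
    module

/-! ### Symplectic Gram–Schmidt over the rationals -/

/-- The projection onto the orthogonal complement of a hyperbolic pair `x, y`. -/
noncomputable def proj (ω : HeisenbergSum →ₗ[ℝ] HeisenbergSum →ₗ[ℝ] ℝ) (x y : HeisenbergSum) :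
    HeisenbergSum →ₗ[ℝ] HeisenbergSum :=
  LinearMap.id - (ω.flip y).smulRight x + (ω.flip x).smulRight y

theorem proj_apply (ω : HeisenbergSum →ₗ[ℝ] HeisenbergSum →ₗ[ℝ] ℝ) (x y u : HeisenbergSum) :
    proj ω x y u = u - ω u y • x + ω u x • y := rfl

section Proj

variable {ω ω' : HeisenbergSum →ₗ[ℝ] HeisenbergSum →ₗ[ℝ] ℝ} {x y : HeisenbergSum}

/-- The coefficients in the projection are values of `ω` on `N`, hence rational. -/
theorem proj_mem (h : IsRationalOn N ω) (hx : x ∈ N) (hy : y ∈ N) {u : HeisenbergSum}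
    (hu : u ∈ N) : proj ω x y u ∈ N := by
  obtain ⟨a, ha⟩ := h u hu x hx
  obtain ⟨b, hb⟩ := h u hu y hy
  rw [proj_apply, ← ha, ← hb]
  exact N.add_mem (N.sub_mem hu (smul_mem_of_rat hx b)) (smul_mem_of_rat hy a)

theorem proj_left (hself : ∀ u, ω u u = 0) (hswap : ∀ u v, ω u v = -ω v u) (hxy : ω x y = 1)
    (u : HeisenbergSum) : ω (proj ω x y u) x = 0 := by
  simp [proj_apply, hself, hswap y x, hxy]

theorem proj_right (hself : ∀ u, ω u u = 0) (hxy : ω x y = 1)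
    (u : HeisenbergSum) : ω (proj ω x y u) y = 0 := by
  simp [proj_apply, hself, hxy]

/-- Splitting off a hyperbolic pair of one form does not disturb the other form when the pair lies
in the radical of the latter. -/
theorem form_proj_left (hx : ∀ v, ω' x v = 0) (hy : ∀ v, ω' y v = 0) (u v : HeisenbergSum) :
    ω' (proj ω x y u) v = ω' u v := by
  simp [proj_apply, hx, hy]

theorem form_proj_right (hx : ∀ v, ω' v x = 0) (hy : ∀ v, ω' v y = 0) (u v : HeisenbergSum) :
    ω' u (proj ω x y v) = ω' u v := by
  simp [proj_apply, hx, hy]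

theorem exists_smul_form_eq_one (h : IsRationalOn N ω) (hx : x ∈ N) (hy : y ∈ N)
    (hxy : ω x y ≠ 0) : ∃ t : ℝ, t • x ∈ N ∧ ω (t • x) y = 1 := by
  obtain ⟨a, ha⟩ := h x hx y hy
  refine ⟨(a⁻¹ : ℚ), smul_mem_of_rat hx _, ?_⟩
  rw [← ha] at hxy
  simp [← ha, hxy]

end Proj

theorem smul_ω₁_self (c : ℝ) (u : HeisenbergSum) : (c • ω₁) u u = 0 := by
  simp [ω₁_self]

theorem smul_ω₂_self (c : ℝ) (u : HeisenbergSum) : (c • ω₂) u u = 0 := by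
  simp [ω₂_self]

theorem smul_ω₁_swap (c : ℝ) (u v : HeisenbergSum) : (c • ω₁) u v = -(c • ω₁) v u := by
  simp [ω₁_swap u v]

theorem smul_ω₂_swap (c : ℝ) (u v : HeisenbergSum) : (c • ω₂) u v = -(c • ω₂) v u := by
  simp [ω₂_swap u v]

/-- A rational form contains a symplectic family of four vectors for the form of `𝔥₅`. -/
theorem exists_symplectic_family (hN : IsRationalForm N) {c : ℝ} (hc : c ≠ 0)
    (h : IsRationalOn N (c • ω₂)) :
    ∃ x ∈ N, ∃ y ∈ N, ∃ x' ∈ N, ∃ y' ∈ N, (c • ω₂) x y = 1 ∧ (c • ω₂) x' y' = 1 ∧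
      (c • ω₂) x' x = 0 ∧ (c • ω₂) x' y = 0 ∧ (c • ω₂) y' x = 0 ∧ (c • ω₂) y' y = 0 := by
  set q := c • ω₂ with hq
  have hself : ∀ u, q u u = 0 := smul_ω₂_self c
  have hswap : ∀ u v, q u v = -q v u := smul_ω₂_swap c
  obtain ⟨x, hx, y, hy, hxy⟩ : ∃ x ∈ N, ∃ y ∈ N, q x y = 1 := by
    obtain ⟨x, hx, y, hy, hxy⟩ : ∃ x ∈ N, ∃ y ∈ N, q x y ≠ 0 := by
      by_contra! h0
      exact smul_ne_zero hc ω₂_ne_zero (eq_zero_of_forall_mem hN h0)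
    obtain ⟨t, ht, h1⟩ := exists_smul_form_eq_one h hx hy hxy
    exact ⟨_, ht, y, hy, h1⟩
  have hl := proj_left hself hswap hxy
  have hr := proj_right hself hxy
  obtain ⟨u, hu, v, hv, huv⟩ : ∃ u ∈ N, ∃ v ∈ N, q (proj q x y u) (proj q x y v) ≠ 0 := by
    -- If `q` vanished on the complement of the first pair, it would have rank two and satisfy the
    -- Plücker relation `pl`, which fails on the generators of `𝔥₅`.
    by_contra! h0
    have h1 : q.compl₁₂ (proj q x y) (proj q x y) = 0 := eq_zero_of_forall_mem hN h0
    have h2 (u v) : q u v = q u y * q x v - q u x * q y v := by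
      have e : q (proj q x y u) (proj q x y v) = 0 := LinearMap.congr_fun₂ h1 u v
      rw [proj_apply q x y v, map_add, map_sub, map_smul, map_smul, hl, hr, proj_apply] at e
      simp only [map_add, map_sub, map_smul, LinearMap.add_apply, LinearMap.sub_apply,
        LinearMap.smul_apply, smul_eq_mul] at e
      linear_combination e
    have pl (a b c d) : q a b * q c d - q a c * q b d + q a d * q b c = 0 := by
      rw [h2 a b, h2 c d, h2 a c, h2 b d, h2 a d, h2 b c]
      rw [hswap x b, hswap x c, hswap x d, hswap y b, hswap y c, hswap y d]
      ring
    have := pl (X' 0) (Y' 0) (X' 1) (Y' 1)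
    simp [hq, ω₂_apply, X', Y', hc] at this
  obtain ⟨t, ht, h1⟩ := exists_smul_form_eq_one h (proj_mem h hx hy hu) (proj_mem h hx hy hv) huv
  refine ⟨x, hx, y, hy, _, ht, _, proj_mem h hx hy hv, hxy, h1, ?_, ?_, hl v, hr v⟩
  · rw [map_smul, LinearMap.smul_apply, hl, smul_zero]
  · rw [map_smul, LinearMap.smul_apply, hr, smul_zero]

/-- A rational form contains a basis of `𝔥₃ ⊕ 𝔥₅` modulo the center satisfying the standard
bracket relations up to two real factors. -/
theorem exists_adapted_family (hN : IsRationalForm N) :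
    ∃ c₁ c₂ : ℝ, c₁ ≠ 0 ∧ c₂ ≠ 0 ∧ ∃ x₀ ∈ N, ∃ y₀ ∈ N, ∃ x ∈ N, ∃ y ∈ N, ∃ x' ∈ N, ∃ y' ∈ N,
      (∀ v, ω₂ x₀ v = 0) ∧ (∀ v, ω₂ y₀ v = 0) ∧ (∀ v, ω₁ x v = 0) ∧ (∀ v, ω₁ y v = 0) ∧
      (∀ v, ω₁ x' v = 0) ∧ (∀ v, ω₁ y' v = 0) ∧ ω₁ x₀ y₀ = c₁ ∧ ω₂ x y = c₂ ∧ ω₂ x' y' = c₂ ∧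
      ω₂ x' x = 0 ∧ ω₂ x' y = 0 ∧ ω₂ y' x = 0 ∧ ω₂ y' y = 0 := by
  obtain ⟨c₁, c₂, hc₁, hc₂, hp, hq⟩ := exists_smul_isRationalOn hN
  obtain ⟨x, hx, y, hy, x', hx', y', hy', h1, h1', hxx, hxy, hyx, hyy⟩ :=
    exists_symplectic_family hN hc₂ hq
  have toω₂ {u v} (h : (c₂ • ω₂) u v = 0) : ω₂ u v = 0 := by simpa [hc₂] using h
  have toω₂' {u v} (h : (c₂ • ω₂) u v = 1) : ω₂ u v = c₂⁻¹ :=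
    eq_inv_of_mul_eq_one_right h
  -- the projection onto the radical of `ω₂`
  obtain ⟨P, hPN, hP, hPid⟩ : ∃ P : HeisenbergSum →ₗ[ℝ] HeisenbergSum, (∀ u ∈ N, P u ∈ N) ∧
      (∀ u v, ω₂ (P u) v = 0) ∧ ∀ u, (∀ v, ω₂ u v = 0) → P u = u := by
    -- The two pairs are mutually orthogonal, so the second projection preserves orthogonality to
    -- the first pair. The result is orthogonal to all four vectors, hence in the radical as `ω₂`
    -- has rank four.
    refine ⟨proj (c₂ • ω₂) x' y' ∘ₗ proj (c₂ • ω₂) x y,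
      fun u hu => proj_mem hq hx' hy' (proj_mem hq hx hy hu), fun u => ?_, fun u hu => ?_⟩
    · have hself := smul_ω₂_self c₂
      have hswap := smul_ω₂_swap c₂
      have a := proj_left hself hswap h1 u
      have b := proj_right hself h1 u
      rw [LinearMap.comp_apply]
      set w := proj (c₂ • ω₂) x y u
      refine ω₂_eq_zero_of_orthogonal (x := x) (y := y) (x' := x') (y' := y')
        (by rw [toω₂' h1]; exact inv_ne_zero hc₂) (by rw [toω₂' h1']; exact inv_ne_zero hc₂)
        (by rw [ω₂_swap, toω₂ hxx, neg_zero]) (by rw [ω₂_swap, toω₂ hyx, neg_zero])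
        (toω₂ ?_) (toω₂ ?_) (toω₂ (proj_left hself hswap h1' w)) (toω₂ (proj_right hself h1' w))
      · rw [proj_apply, map_add, map_sub, map_smul, map_smul, LinearMap.add_apply,
          LinearMap.sub_apply, LinearMap.smul_apply _ (_ : HeisenbergSum →ₗ[ℝ] ℝ),
          LinearMap.smul_apply _ (_ : HeisenbergSum →ₗ[ℝ] ℝ), a, hxx, hyx]
        simp
      · rw [proj_apply, map_add, map_sub, map_smul, map_smul, LinearMap.add_apply,
          LinearMap.sub_apply, LinearMap.smul_apply _ (_ : HeisenbergSum →ₗ[ℝ] ℝ),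
          LinearMap.smul_apply _ (_ : HeisenbergSum →ₗ[ℝ] ℝ), b, hxy, hyy]
        simp
    · simp [proj_apply, hu]
  obtain ⟨x₀, hx₀, y₀, hy₀, hp0, rx₀, ry₀⟩ : ∃ x₀ ∈ N, ∃ y₀ ∈ N, (c₁ • ω₁) x₀ y₀ = 1 ∧
      (∀ v, ω₂ x₀ v = 0) ∧ ∀ v, ω₂ y₀ v = 0 := by
    obtain ⟨u, hu, v, hv, huv⟩ : ∃ u ∈ N, ∃ v ∈ N, (c₁ • ω₁) (P u) (P v) ≠ 0 := by
      by_contra! h0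
      -- Vanishing on `P N` extends to the whole image of `P`, which contains `X` and `Y` because
      -- they lie in the radical of `ω₂`.
      have h1 : (c₁ • ω₁).compl₁₂ P P = 0 := eq_zero_of_forall_mem hN h0
      have e : (c₁ • ω₁) (P X) (P Y) = 0 := LinearMap.congr_fun₂ h1 X Y
      rw [hPid X (by simp [ω₂_apply, X]), hPid Y (by simp [ω₂_apply, Y])] at e
      simp [ω₁_apply, X, Y, hc₁] at e
    obtain ⟨t, ht, h1⟩ := exists_smul_form_eq_one hp (hPN u hu) (hPN v hv) huv
    exact ⟨_, ht, _, hPN v hv, h1, fun w => by simp [hP], hP v⟩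
  have hp0' : ω₁ x₀ y₀ = c₁⁻¹ := eq_inv_of_mul_eq_one_right hp0
  -- the projection onto the radical of `ω₁`
  set ρ := proj (c₁ • ω₁) x₀ y₀ with hρ
  have hρN : ∀ u ∈ N, ρ u ∈ N := fun u hu => proj_mem hp hx₀ hy₀ hu
  have hρ1 (u v) : ω₁ (ρ u) v = 0 := by
    refine ω₁_eq_zero_of_orthogonal (x := x₀) (y := y₀) (by rw [hp0']; exact inv_ne_zero hc₁) ?_ ?_ v
    · simpa [hc₁] using proj_left (smul_ω₁_self c₁) (smul_ω₁_swap c₁) hp0 u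
    · simpa [hc₁] using proj_right (smul_ω₁_self c₁) hp0 u
  have hρ2 (u v) : ω₂ (ρ u) (ρ v) = ω₂ u v := by
    rw [hρ, form_proj_left rx₀ ry₀, form_proj_right]
    · exact fun w => by rw [ω₂_swap, rx₀, neg_zero]
    · exact fun w => by rw [ω₂_swap, ry₀, neg_zero]
  refine ⟨c₁⁻¹, c₂⁻¹, inv_ne_zero hc₁, inv_ne_zero hc₂, x₀, hx₀, y₀, hy₀, ρ x, hρN x hx, ρ y,
    hρN y hy, ρ x', hρN x' hx', ρ y', hρN y' hy', rx₀, ry₀, hρ1 x, hρ1 y, hρ1 x', hρ1 y', hp0', ?_⟩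
  simp only [hρ2]
  exact ⟨toω₂' h1, toω₂' h1', toω₂ hxx, toω₂ hxy, toω₂ hyx, toω₂ hyy⟩

/-! ### The standard rational form and the automorphism onto it -/

/-- The standard rational form. -/
noncomputable def ofRat : HeisenbergLie 1 ℚ × HeisenbergLie 2 ℚ →ₗ⁅ℚ⁆ HeisenbergSum where
  toFun u := (HeisenbergLie.ofRat 1 u.1, HeisenbergLie.ofRat 2 u.2)
  map_add' u v := Prod.ext (map_add _ u.1 v.1) (map_add _ u.2 v.2)
  map_smul' t u := Prod.ext (map_smul _ t u.1) (map_smul _ t u.2)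
  map_lie' {u v} := Prod.ext (LieHom.map_lie _ u.1 v.1) (LieHom.map_lie _ u.2 v.2)

theorem ofRat_apply (u : HeisenbergLie 1 ℚ × HeisenbergLie 2 ℚ) :
    ofRat u = (HeisenbergLie.ofRat 1 u.1, HeisenbergLie.ofRat 2 u.2) := rfl

theorem ofRat_eq {u : HeisenbergLie 1 ℚ × HeisenbergLie 2 ℚ} {v : HeisenbergSum}
    (h1 : ∀ i, (u.1.1 i : ℝ) = v.1.1 i) (h2 : ∀ i, (u.1.2.1 i : ℝ) = v.1.2.1 i)
    (h3 : (u.1.2.2 : ℝ) = v.1.2.2) (h4 : ∀ i, (u.2.1 i : ℝ) = v.2.1 i)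
    (h5 : ∀ i, (u.2.2.1 i : ℝ) = v.2.2.1 i) (h6 : (u.2.2.2 : ℝ) = v.2.2.2) : ofRat u = v :=
  Prod.ext (ext_iff'.2 ⟨funext h1, funext h2, h3⟩) (ext_iff'.2 ⟨funext h4, funext h5, h6⟩)

theorem ofRat_injective : Function.Injective ofRat := fun _ _ h =>
  Prod.ext (HeisenbergLie.ofRat_injective (congrArg Prod.fst h))
    (HeisenbergLie.ofRat_injective (congrArg Prod.snd h))

theorem finrank_range_ofRat : Module.finrank ℚ ofRat.range = 8 := by
  rw [← (LieEquiv.ofInjective ofRat ofRat_injective).toLinearEquiv.finrank_eq,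
    Module.finrank_prod, HeisenbergLie.finrank_eq, HeisenbergLie.finrank_eq]

/-- The linear map with given values on the standard basis. -/
noncomputable def basisMap (x₀ y₀ x y x' y' : HeisenbergSum) (c₁ c₂ : ℝ) :
    HeisenbergSum →ₗ[ℝ] HeisenbergSum where
  toFun u := u.1.1 0 • x₀ + u.1.2.1 0 • y₀ + u.2.1 0 • x + u.2.2.1 0 • y + u.2.1 1 • x' +
    u.2.2.1 1 • y' + u.1.2.2 • central (c₁, 0) + u.2.2.2 • central (0, c₂)
  map_add' u v := by
    simp
    module
  map_smul' t u := by
    simp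
    module

theorem basisMap_apply (x₀ y₀ x y x' y' : HeisenbergSum) (c₁ c₂ : ℝ) (u : HeisenbergSum) :
    basisMap x₀ y₀ x y x' y' c₁ c₂ u =
      u.1.1 0 • x₀ + u.1.2.1 0 • y₀ + u.2.1 0 • x + u.2.2.1 0 • y + u.2.1 1 • x' +
        u.2.2.1 1 • y' + u.1.2.2 • central (c₁, 0) + u.2.2.2 • central (0, c₂) := rfl

theorem eq_basisMap (u : HeisenbergSum) :
    basisMap X Y (X' 0) (Y' 0) (X' 1) (Y' 1) 1 1 u = u := by
  rw [basisMap_apply]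
  refine Prod.ext (ext_iff'.2 ⟨?_, ?_, ?_⟩) (ext_iff'.2 ⟨?_, ?_, ?_⟩)
  · ext i; fin_cases i; simp [X, Y, X', Y', central_apply]
  · ext i; fin_cases i; simp [X, Y, X', Y', central_apply]
  · simp [X, Y, X', Y', central_apply]
  · ext i; fin_cases i <;> simp [X, Y, X', Y', central_apply]
  · ext i; fin_cases i <;> simp [X, Y, X', Y', central_apply]
  · simp [X, Y, X', Y', central_apply]

theorem isRationalForm_range_ofRat : IsRationalForm ofRat.range where
  finrank_eq := by rw [finrank_range_ofRat, finrank_eq_eight]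
  span_eq_top := by
    have hm {u} (v) (h : ofRat v = u) : u ∈ Submodule.span ℝ (ofRat.range : Set HeisenbergSum) :=
      Submodule.subset_span ⟨v, h⟩
    refine eq_top_iff.2 fun u _ => ?_
    rw [← eq_basisMap u, basisMap_apply]
    have hX : X ∈ Submodule.span ℝ (ofRat.range : Set HeisenbergSum) :=
      hm (mk 1 0 0, 0) (ofRat_eq (by simp [X]) (by simp [X]) (by simp [X]) (by simp [X])
        (by simp [X]) (by simp [X]))
    have hY : Y ∈ Submodule.span ℝ (ofRat.range : Set HeisenbergSum) :=
      hm (mk 0 1 0, 0) (ofRat_eq (by simp [Y]) (by simp [Y]) (by simp [Y]) (by simp [Y])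
        (by simp [Y]) (by simp [Y]))
    have hX' (j) : X' j ∈ Submodule.span ℝ (ofRat.range : Set HeisenbergSum) :=
      hm (0, mk (Pi.single j 1) 0 0) (ofRat_eq (by simp [X']) (by simp [X']) (by simp [X'])
        (by simp [X', Pi.single_apply, apply_ite (Rat.cast : ℚ → ℝ)]) (by simp [X']) (by simp [X']))
    have hY' (j) : Y' j ∈ Submodule.span ℝ (ofRat.range : Set HeisenbergSum) :=
      hm (0, mk 0 (Pi.single j 1) 0) (ofRat_eq (by simp [Y']) (by simp [Y']) (by simp [Y'])
        (by simp [Y']) (by simp [Y', Pi.single_apply, apply_ite (Rat.cast : ℚ → ℝ)]) (by simp [Y']))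
    have hZ : central (1, 0) ∈ Submodule.span ℝ (ofRat.range : Set HeisenbergSum) :=
      hm (mk 0 0 1, 0) (ofRat_eq (by simp [central_apply]) (by simp [central_apply])
        (by simp [central_apply]) (by simp [central_apply]) (by simp [central_apply])
        (by simp [central_apply]))
    have hZ' : central (0, 1) ∈ Submodule.span ℝ (ofRat.range : Set HeisenbergSum) :=
      hm (0, mk 0 0 1) (ofRat_eq (by simp [central_apply]) (by simp [central_apply])
        (by simp [central_apply]) (by simp [central_apply]) (by simp [central_apply])
        (by simp [central_apply]))
    have sm {v} (hv : v ∈ Submodule.span ℝ (ofRat.range : Set HeisenbergSum)) (t : ℝ) :=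
      Submodule.smul_mem _ t hv
    exact add_mem (add_mem (add_mem (add_mem (add_mem (add_mem (add_mem
      (sm hX _) (sm hY _)) (sm (hX' 0) _)) (sm (hY' 0) _)) (sm (hX' 1) _)) (sm (hY' 1) _))
      (sm hZ _)) (sm hZ' _)

/-- The map `ψ` from the standard generators to an adapted family of `N` scales each `ωᵢ` by `cᵢ`,
and scales the center in the same way, so it respects brackets. Its kernel lies in both radicals,
hence in the center, where `ψ` is injective. The automorphism sought is its inverse. -/
theorem exists_lieEquiv_image_eq (hN : IsRationalForm N) :
    ∃ A : HeisenbergSum ≃ₗ⁅ℝ⁆ HeisenbergSum, A '' (N : Set HeisenbergSum) = ofRat.range := by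
  obtain ⟨c₁, c₂, hc₁, hc₂, x₀, hx₀, y₀, hy₀, x, hx, y, hy, x', hx', y', hy', rx₀, ry₀, rx, ry,
    rx', ry', h₀, h, h', hxx, hxy, hyx, hyy⟩ := exists_adapted_family hN
  set ψ := basisMap x₀ y₀ x y x' y' c₁ c₂ with hψ
  have form₁ (u v) : ω₁ (ψ u) (ψ v) = c₁ * ω₁ u v := by
    simp [hψ, basisMap_apply, rx, ry, rx', ry', ω₁_central_left, ω₁_central_right, h₀, ω₁_self,
      ω₁_swap y₀ x₀, ω₁_swap _ x, ω₁_swap _ y, ω₁_swap _ x', ω₁_swap _ y', ω₁_apply u v]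
    ring
  have form₂ (u v) : ω₂ (ψ u) (ψ v) = c₂ * ω₂ u v := by
    simp [hψ, basisMap_apply, rx₀, ry₀, ω₂_central_left, ω₂_central_right, h, h', ω₂_self,
      ω₂_swap y x, ω₂_swap y' x', ω₂_swap _ x₀, ω₂_swap _ y₀, ω₂_swap x x', ω₂_swap x y',
      ω₂_swap y x', ω₂_swap y y', hxx, hxy, hyx, hyy, ω₂_apply u v]
    ring
  have hcentral (s) : ψ (central s) = central (c₁ * s.1, c₂ * s.2) := by
    rw [hψ, basisMap_apply, ← map_smul, ← map_smul]
    refine Prod.ext (ext_iff'.2 ⟨?_, ?_, ?_⟩) (ext_iff'.2 ⟨?_, ?_, ?_⟩) <;>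
      simp [central_apply, mul_comm]
  have hinj : Function.Injective ψ := by
    rw [injective_iff_map_eq_zero]
    intro u hu
    have e := eq_central_of_forms_eq_zero (u := u)
      (fun v => by simpa [hu, hc₁] using (form₁ u v).symm)
      (fun v => by simpa [hu, hc₂] using (form₂ u v).symm)
    rw [e, hcentral, map_eq_zero_iff _ central_injective] at hu
    have e1 : c₁ * u.1.2.2 = 0 := congrArg Prod.fst hu
    have e2 : c₂ * u.2.2.2 = 0 := congrArg Prod.snd hu
    rw [e, (mul_eq_zero.1 e1).resolve_left hc₁, (mul_eq_zero.1 e2).resolve_left hc₂]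
    exact map_zero central
  let Ψ : HeisenbergSum →ₗ⁅ℝ⁆ HeisenbergSum :=
    { ψ with
      map_lie' := fun {u v} => by
        change ψ ⁅u, v⁆ = ⁅ψ u, ψ v⁆
        rw [lie_eq_central, lie_eq_central, hcentral, form₁, form₂] }
  let A : HeisenbergSum ≃ₗ⁅ℝ⁆ HeisenbergSum :=
    LieEquiv.ofBijective Ψ ⟨hinj, LinearMap.injective_iff_surjective.1 hinj⟩
  have hz₁ : central (c₁, 0) ∈ N := by
    have := N.lie_mem hx₀ hy₀
    rwa [lie_eq_central, h₀, rx₀] at this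
  have hz₂ : central (0, c₂) ∈ N := by
    have := N.lie_mem hx hy
    rwa [lie_eq_central, h, rx] at this
  -- The image of the standard form lies in `N`, and both have dimension 8 over `ℚ`.
  have hle : ofRat.range.toSubmodule.map (ψ.restrictScalars ℚ) = N.toSubmodule := by
    have hfin : Module.Finite ℚ N.toSubmodule := Module.finite_of_finrank_pos (by
      have := hN.finrank_eq
      rw [finrank_eq_eight] at this
      exact this ▸ (by norm_num : 0 < 8))
    refine Submodule.eq_of_le_of_finrank_eq ?_ ?_
    · rintro _ ⟨_, ⟨u, rfl⟩, rfl⟩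
      change ψ (ofRat u) ∈ N
      rw [hψ, basisMap_apply]
      have := @smul_mem_of_rat N
      exact N.add_mem (N.add_mem (N.add_mem (N.add_mem (N.add_mem (N.add_mem (N.add_mem
        (this hx₀ _) (this hy₀ _)) (this hx _)) (this hy _)) (this hx' _)) (this hy' _))
        (this hz₁ _)) (this hz₂ _)
    · rw [← (Submodule.equivMapOfInjective (ψ.restrictScalars ℚ) hinj _).finrank_eq]
      exact finrank_range_ofRat.trans (hN.finrank_eq.trans finrank_eq_eight).symm
  refine ⟨A.symm, ?_⟩
  have himage : A '' (ofRat.range : Set HeisenbergSum) = N := congrArg SetLike.coe hle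
  rw [← himage, Set.image_image]
  simp

theorem nonempty_lieEquiv_of_rationalFormsIsomorphic {N₁ N₂ : LieSubalgebra ℚ HeisenbergSum}
    (h : RationalFormsIsomorphic N₁ N₂) : Nonempty (N₁ ≃ₗ⁅ℚ⁆ N₂) := by
  obtain ⟨A, hA⟩ := h
  let A' : HeisenbergSum ≃ₗ⁅ℚ⁆ HeisenbergSum :=
    { A.toLinearEquiv.restrictScalars ℚ with map_lie' := fun {u v} => A.map_lie u v }
  exact ⟨LieEquiv.ofSubalgebras _ _ A' (SetLike.coe_injective hA)⟩

end HeisenbergSum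

theorem mainTheorem10 :
    HasNilpotentType ℝ (HeisenbergLie 1 ℝ × HeisenbergLie 2 ℝ) [6, 2] ∧
    (∃ N₀ : LieSubalgebra ℚ (HeisenbergLie 1 ℝ × HeisenbergLie 2 ℝ),
      IsRationalForm N₀ ∧
      Nonempty (N₀ ≃ₗ⁅ℚ⁆ HeisenbergLie 1 ℚ × HeisenbergLie 2 ℚ) ∧
      ∀ N : LieSubalgebra ℚ (HeisenbergLie 1 ℝ × HeisenbergLie 2 ℝ),
        IsRationalForm N → RationalFormsIsomorphic N N₀ ∧ Nonempty (N ≃ₗ⁅ℚ⁆ N₀)) ∧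
    formOrbit (cubicXYY ℝ) ∩ Set.range (MvPolynomial.map (algebraMap ℚ ℝ)) =
      MvPolynomial.map (algebraMap ℚ ℝ) '' formOrbit (cubicXYY ℚ) := by
  refine ⟨HeisenbergSum.hasNilpotentType, ⟨HeisenbergSum.ofRat.range,
    HeisenbergSum.isRationalForm_range_ofRat,
    ⟨(LieEquiv.ofInjective _ HeisenbergSum.ofRat_injective).symm⟩, fun N hN => ?_⟩,
    formOrbit_cubicXYY_inter_rational⟩
  have h : RationalFormsIsomorphic N HeisenbergSum.ofRat.range :=
    HeisenbergSum.exists_lieEquiv_image_eq hN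
  exact ⟨h, HeisenbergSum.nonempty_lieEquiv_of_rationalFormsIsomorphic h⟩
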